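/- **Setting.** Let $c\in\mathbb{R}^n$, $b\in\mathbb{R}^m$, $A\in\mathbb{R}^{m\times n}$, let $Q\in\mathbb{R}^{n\times n}$ be symmetric positive semidefinite, $g(x)=\|Dx\|_1$ with $D$ diagonal and positive semidefinite, and $\mathcal K=\{x\in\mathbb{R}^n: l\le x\le u\}$ with possibly infinite bounds $l\le u$ ($l_i<+\infty$, $u_i>-\infty$). Write $\delta_{\mathcal K}$ for the indicator function, $f^*$ for the Fenchel conjugate, $\partial$ for the convex subdifferential and $\Pi_{\mathcal K}$ for the Euclidean projection. Consider the primal problem $$\min_x\ c^\top x+\tfrac12x^\top Qx+g(x)+\delta_{\mathcal K}(x)\quad\text{s.t. } Ax=b,$$ and the dual problem $$\max_{x,y,z}\ b^\top y-\tfrac12x^\top Qx-\delta_{\mathcal K}^*(z)-g^*(A^\top y-c-Qx-z).$$ For $p=(x,y,z)\in\mathbb{R}^n\times\mathbb{R}^m\times\mathbb{R}^n$ let $T_\ell(p)$ be the set of all $(v',u',w')$ with $$v'\in Qx+c-A^\top y+z+\partial g(x),\qquad u'=Ax-b,\qquad z\in\partial\delta_{\mathcal K}(x+w'),$$ and let $T_\ell^{-1}(0)=\{p: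 0\in T_\ell(p)\}$. For $\tau_k>0$ put $R_k=\tau_kI_n\oplus I_m\oplus I_n$, $\|p\|_{R_k}=\sqrt{p^\top R_kp}$ and $\mathrm{dist}_{R_k}(p,S)=\inf_{q\in S}\|p-q\|_{R_k}$; $\mathrm{dist}$ is the Euclidean distance (with $\inf\emptyset=+\infty$). **Algorithm (PD-PMM).** Let $0<\beta_0\le\beta_1\le\cdots$ with $\beta_k\to\beta_\infty\le\infty$, let $\{\tau_k\}$ be non-increasing with limit $\tau_\infty>0$, let $\rho_k=\beta_k/\tau_k$, and let $\epsilon_k\ge0$ with $\epsilon_k\to0$. From $p_0=(x_0,y_0,z_0)$, iterates $p_k=(x_k,y_k,z_k)$ are generated for $k\ge0$ by choosing any $(x_{k+1},y_{k+1})$ with $\mathrm{dist}(0,F_{\beta_k,\rho_k}(x_{k+1},y_{k+1}))\le\epsilon_k$ and setting $$z_{k+1}=z_k+\beta_kx_{k+1}-\beta_k\Pi_{\mathcal K}(\beta_k^{-1}z_k+x_{k+1}),$$ where $$F_{\beta_k,\rho_k}(x,y)=\{(u',v'): u'\in r_{\beta_k,\rho_k}(x,y)+\partial g(x),\ v'=Ax+\beta_k^{-1}(y-y_k)-b\},$$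 $$r_{\beta_k,\rho_k}(x,y)=c+Qx-A^\top y+(z_k+\beta_kx)-\beta_k\Pi_{\mathcal K}(\beta_k^{-1}z_k+x)+\rho_k^{-1}(x-x_k).$$ **Theorem.** Assume that the primal and the dual problem are both feasible (the latter meaning that $\delta_{\mathcal K}^*(z)$ and $g^*(A^\top y-c-Qx-z)$ are both $<+\infty$ for some $(x,y,z)$). Let $\delta_k\ge0$ with $\sum_{k=0}^\infty\delta_k<\infty$, and $0\le\delta_k'<1$ with $\sum_{k=0}^\infty\delta_k'<\infty$. Let $r>\sum_{k=0}^\infty\delta_k$, and let $\kappa>0$ be such that $$\mathrm{dist}(p,T_\ell^{-1}(0))\le\kappa\,\mathrm{dist}(0,T_\ell(p))\quad\text{for all }p\text{ with }\mathrm{dist}(p,T_\ell^{-1}(0))\le r.$$ Let $\{p_k\}$ be generated by PD-PMM with $\mathrm{dist}_{R_0}(p_0,T_\ell^{-1}(0))\le r-\sum_{k=0}^\infty\delta_k$ and $$\epsilon_k\le\frac{\min\{\sqrt{\tau_k},1\}}{\beta_k}\min\{\delta_k,\ \delta_k'\|p_{k+1}-p_k\|_{R_k}\}\qquad\text{for all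 }k\ge0.$$ Then, for all $k\ge0$, $$\mathrm{dist}_{R_{k+1}}(p_{k+1},T_\ell^{-1}(0))\le\mu_k\,\mathrm{dist}_{R_k}(p_k,T_\ell^{-1}(0)),$$ $$\mu_k=(1-\delta_k')^{-1}\Big(\delta_k'+(1+\delta_k')\frac{\kappa\gamma_k}{\sqrt{\beta_k^2+\kappa^2\gamma_k^2}}\Big),\qquad\gamma_k=\max\{\tau_k,1\}.$$ Moreover, $$\lim_{k\to\infty}\mu_k=\mu_\infty=\frac{\kappa\gamma_\infty}{\sqrt{\beta_\infty^2+\kappa^2\gamma_\infty^2}},\qquad\gamma_\infty=\max\{\tau_\infty,1\},$$ with $\mu_\infty=0$ if $\beta_\infty=\infty$ (superlinear convergence). -/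

import Mathlib

open Filter Topology

noncomputable section

namespace PDPMM

/-- `ℝⁿ` with the Euclidean norm. -/
abbrev E (n : ℕ) := EuclideanSpace ℝ (Fin n)

/-- Primal-dual triples `(x, y, z) ∈ ℝⁿ × ℝᵐ × ℝⁿ`. Only the vector space structure of the product
is used; norms of triples are always the (weighted) Euclidean norms `normR` below. -/
abbrev Triple (n m : ℕ) := E n × E m × E n

/-- Matrix-vector product on Euclidean spaces. -/
def mulE {p q : ℕ} (M : Matrix (Fin p) (Fin q) ℝ) (x : E q) : E p :=
  WithLp.toLp 2 (M.mulVec x.ofLp)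

/-! ### Convex analysis -/

/-- The indicator function of a set in the sense of convex analysis. -/
def indicatorFn {V : Type*} (S : Set V) (x : V) : EReal :=
  letI := Classical.dec (x ∈ S)
  if x ∈ S then 0 else ⊤

/-- The Fenchel conjugate `f*(v) = sup_x {⟨v, x⟩ - f x}`. -/
def conjugate {n : ℕ} (f : E n → EReal) (v : E n) : EReal :=
  ⨆ x : E n, ((inner ℝ v x : ℝ) : EReal) - f x

/-- The convex subdifferential (empty outside the effective domain). -/
def subdifferential {n : ℕ} (f : E n → EReal) (x : E n) : Set (E n) :=
  {v | f x ≠ ⊤ ∧ ∀ x' : E n, f x + ((inner ℝ v (x' - x) : ℝ) : EReal) ≤ f x'}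

/-- The Euclidean projection: a point of `S` nearest to `p`
(for nonempty closed convex `S` there is exactly one). -/
def proj {n : ℕ} (S : Set (E n)) (p : E n) : E n :=
  Classical.epsilon fun w => w ∈ S ∧ ∀ v ∈ S, ‖p - w‖ ≤ ‖p - v‖

/-! ### The problem -/

/-- Data of the problem
`min cᵀx + ½ xᵀQx + ‖Dx‖₁ + δ_K(x)  s.t.  Ax = b`, with `K = {x | l ≤ x ≤ u}`. -/
structure Problem (n m : ℕ) where
  c : E n
  Q : Matrix (Fin n) (Fin n) ℝ
  A : Matrix (Fin m) (Fin n) ℝ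
  b : E m
  D : Matrix (Fin n) (Fin n) ℝ
  l : Fin n → EReal
  u : Fin n → EReal
  Q_psd : Q.PosSemidef
  D_diag : D.IsDiag
  D_psd : D.PosSemidef
  l_ne_top : ∀ i, l i ≠ ⊤
  u_ne_bot : ∀ i, u i ≠ ⊥
  l_le_u : ∀ i, l i ≤ u i

namespace Problem

variable {n m : ℕ} (P : Problem n m)

/-- The box `K`. -/
def K : Set (E n) :=
  {x | ∀ i, P.l i ≤ ((x i : ℝ) : EReal) ∧ ((x i : ℝ) : EReal) ≤ P.u i}

/-- `g(x) = ‖Dx‖₁`. -/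
def g (x : E n) : EReal := ((∑ i, |mulE P.D x i| : ℝ) : EReal)

/-- The primal problem is feasible. -/
def PrimalFeasible : Prop := ∃ x ∈ P.K, mulE P.A x = P.b

/-- The dual problem
`max bᵀy - ½ xᵀQx - δ_K*(z) - g*(Aᵀy - c - Qx - z)` is feasible:
some `(x, y, z)` lies in the domain of its objective. -/
def DualFeasible : Prop :=
  ∃ (x : E n) (y : E m) (z : E n),
    conjugate (indicatorFn P.K) z < ⊤ ∧
    conjugate P.g (mulE P.A.transpose y - P.c - mulE P.Q x - z) < ⊤

/-- The maximal monotone operator `T_ℓ` of the Lagrangian; the rows are listed in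
the order of the variables `x`, `y`, `z`. -/
def T (p : Triple n m) : Set (Triple n m) :=
  {w | (∃ s ∈ subdifferential P.g p.1,
          w.1 = mulE P.Q p.1 + P.c - mulE P.A.transpose p.2.1 + p.2.2 + s) ∧
       w.2.1 = mulE P.A p.1 - P.b ∧
       p.2.2 ∈ subdifferential (indicatorFn P.K) (p.1 + w.2.2)}

/-- `T_ℓ⁻¹(0)`. -/
def solutionSet : Set (Triple n m) := {p | (0 : Triple n m) ∈ P.T p}

/-- The vector `r_{β,ρ}(x, y)`, at the current iterate `(x_k, y_k, z_k) = pk`. -/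
def residual (β ρ : ℝ) (pk : Triple n m) (x : E n) (y : E m) : E n :=
  P.c + mulE P.Q x - mulE P.A.transpose y + (pk.2.2 + β • x)
    - β • proj P.K (β⁻¹ • pk.2.2 + x) + ρ⁻¹ • (x - pk.1)

/-- The set `F_{β,ρ}(x, y)`, at the current iterate `(x_k, y_k, z_k) = pk`. -/
def F (β ρ : ℝ) (pk : Triple n m) (x : E n) (y : E m) : Set (E n × E m) :=
  {w | (∃ s ∈ subdifferential P.g x, w.1 = P.residual β ρ pk x y + s) ∧
       w.2 = mulE P.A x + β⁻¹ • (y - pk.2.1) - P.b}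

end Problem

/-! ### Norms and distances -/

/-- `‖p‖_R` for `R = τ I_n ⊕ I_m ⊕ I_n`. -/
def normR {n m : ℕ} (τ : ℝ) (p : Triple n m) : ℝ :=
  Real.sqrt (τ * ‖p.1‖ ^ 2 + ‖p.2.1‖ ^ 2 + ‖p.2.2‖ ^ 2)

/-- `dist_R(p, S)` for `R = τ I_n ⊕ I_m ⊕ I_n`, with the convention `inf ∅ = ∞`. -/
def distR {n m : ℕ} (τ : ℝ) (p : Triple n m) (S : Set (Triple n m)) : ENNReal :=
  ⨅ q ∈ S, ENNReal.ofReal (normR τ (p - q))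

/-- The Euclidean distance of a triple to a set. -/
def dist2 {n m : ℕ} (p : Triple n m) (S : Set (Triple n m)) : ENNReal := distR 1 p S

/-- The Euclidean distance of the origin to a set of pairs. -/
def distZeroPair {n m : ℕ} (S : Set (E n × E m)) : ENNReal :=
  ⨅ w ∈ S, ENNReal.ofReal (Real.sqrt (‖w.1‖ ^ 2 + ‖w.2‖ ^ 2))

/-! ### The algorithm -/

/-- `p k = (x_k, y_k, z_k)` is a sequence of iterates of the primal-dual proximal method of
multipliers with penalties `β k ↗ βinf ≤ ∞`, `ρ k = β k / τ k`, where `τ k ↘ τinf > 0`, and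
tolerances `ε k → 0`. -/
structure IsRun {n m : ℕ} (P : Problem n m) (β : ℕ → ℝ) (βinf : EReal) (τ : ℕ → ℝ) (τinf : ℝ)
    (ε : ℕ → ℝ) (p : ℕ → Triple n m) : Prop where
  β_pos : 0 < β 0
  β_mono : Monotone β
  β_lim : Tendsto (fun k => ((β k : ℝ) : EReal)) atTop (𝓝 βinf)
  τinf_pos : 0 < τinf
  τ_anti : Antitone τ
  τ_lim : Tendsto τ atTop (𝓝 τinf)
  ε_nonneg : ∀ k, 0 ≤ ε k
  ε_lim : Tendsto ε atTop (𝓝 0)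
  subproblem : ∀ k,
    distZeroPair (P.F (β k) (β k / τ k) (p k) (p (k + 1)).1 (p (k + 1)).2.1)
      ≤ ENNReal.ofReal (ε k)
  z_update : ∀ k,
    (p (k + 1)).2.2 = ((p k).2.2 + β k • (p (k + 1)).1)
      - β k • proj P.K ((β k)⁻¹ • (p k).2.2 + (p (k + 1)).1)

/-! ### The rate -/

/-- The contraction factor, with `γ = max {τ, 1}`. -/
def rate (κ β τ δ' : ℝ) : ℝ :=
  (1 - δ')⁻¹ *
    (δ' + (1 + δ') * (κ * max τ 1 / Real.sqrt (β ^ 2 + κ ^ 2 * (max τ 1) ^ 2)))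

/-- The limiting factor, with `γ_∞ = max {τ_∞, 1}`; it is `0` if `β_∞ = ∞`. -/
def rateLimit (κ : ℝ) (βinf : EReal) (τinf : ℝ) : ℝ :=
  letI := Classical.dec (βinf = ⊤)
  if βinf = ⊤ then 0
  else κ * max τinf 1 / Real.sqrt (βinf.toReal ^ 2 + κ ^ 2 * (max τinf 1) ^ 2)

end PDPMM

end

namespace PDPMM

/-! One iteration is an inexact proximal-point step for the monotone operator `P.T` in the metric `R
= τ I ⊕ I ⊕ I`: the exact step from `p` finds `q` and `w ∈ P.T q` with `R (q - p) + β w = 0`, and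
the tolerance only perturbs the first two rows of this equation.

For the exact step, monotonicity gives `dist_R(q)² + ‖p - q‖_R² ≤ dist_R(p)²`, distances being to
the solution set. Since `w` is a multiple of `R (p - q)`, the error bound at `q` turns into `β
dist_R(q) ≤ κ γ ‖p - q‖_R`. Eliminating `‖p - q‖_R` yields the factor `κγ / √(β² + κ²γ²)`
(`Problem.proximal_step`). Monotonicity also bounds the gap between the inexact and the exact point
by `β ε / min(√τ, 1)` (`Problem.normR_sub_proximal_le`), and the triangle inequality produces `rate`
(`Problem.inexact_step`).

The delicate point is that the error bound holds within Euclidean distance `r`, whereas the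
iteration controls the `R`-distance, which is smaller when `τ < 1`. `infDist_le_or_le_mul_norm`
closes this gap: beyond distance `r`, the operator has norm at least `r / κ`. Its proof follows the
resolvent curve from the far point towards a zero and applies the error bound where the curve
crosses distance `r`. -/

/-! ### Error bounds for monotone operators -/

section Monotone

variable {H : Type*} [NormedAddCommGroup H] [InnerProductSpace ℝ H]

/-- The inequality between two resolvents of the same point. -/
lemma resolvent_compare {a b : H} {s t : ℝ} (hs : 1 ≤ s) (hst : s ≤ t)
    (h : 0 ≤ inner ℝ (a - b) (t • b - s • a)) :
    ‖b‖ ≤ ‖a‖ ∧ ‖a - b‖ ≤ (t - s) * ‖b‖ := by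
  -- `a` and `b` play the operator values at the resolvents `p - s • a` and `p - t • b` of a common
  -- point `p`, so `h` is monotonicity between these two points.
  have e : inner ℝ (a - b) (t • b - s • a)
      = (t - s) * inner ℝ (a - b) b - s * ‖a - b‖ ^ 2 := by
    have : t • b - s • a = (t - s) • b - s • (a - b) := by module
    rw [this, inner_sub_right, inner_smul_right, inner_smul_right, real_inner_self_eq_norm_sq]
  rw [e] at h
  have cs := real_inner_le_norm (a - b) b
  have h2 : ‖a - b‖ ≤ (t - s) * ‖b‖ := by
    rcases (norm_nonneg (a - b)).eq_or_lt with h0 | h0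
    · rw [← h0]; exact mul_nonneg (by linarith) (norm_nonneg _)
    · have h3 : ‖a - b‖ ^ 2 ≤ (t - s) * (‖a - b‖ * ‖b‖) := by
        have := mul_le_mul_of_nonneg_left cs (by linarith : 0 ≤ t - s)
        nlinarith [sq_nonneg ‖a - b‖]
      refine le_of_mul_le_mul_left ?_ h0
      nlinarith
  refine ⟨?_, h2⟩
  rcases hst.eq_or_lt with h0 | h0
  · subst h0
    have : ‖a - b‖ ≤ 0 := by simpa using h2
    have : a = b := by simpa [sub_eq_zero] using this
    rw [this]
  · have h4 : 0 ≤ inner ℝ (a - b) b := by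
      by_contra! hneg
      nlinarith [sq_nonneg ‖a - b‖, mul_pos (sub_pos.2 h0) (neg_pos.2 hneg)]
    rw [inner_sub_left, real_inner_self_eq_norm_sq] at h4
    have cs2 := real_inner_le_norm a b
    rcases (norm_nonneg b).eq_or_lt with hb | hb
    · rw [← hb]; exact norm_nonneg _
    · exact le_of_mul_le_mul_right (by nlinarith) hb

/-- If an error bound holds up to distance `r` from the zeros of a monotone operator with full
resolvents, then farther away the operator is bounded below. -/
theorem infDist_le_or_le_mul_norm [ProperSpace H] {T : H → Set H}
    (mono : ∀ q v q' v', v ∈ T q → v' ∈ T q' → 0 ≤ inner ℝ (v - v') (q - q'))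
    (surj : ∀ p : H, ∀ t : ℝ, 0 < t → ∃ q, ∃ v ∈ T q, q + t • v = p)
    (hne : {q | (0 : H) ∈ T q}.Nonempty) {r κ : ℝ} (hr : 0 < r) (hκ : 0 ≤ κ)
    (herr : ∀ q, Metric.infDist q {q | (0 : H) ∈ T q} ≤ r → ∀ v ∈ T q,
      Metric.infDist q {q | (0 : H) ∈ T q} ≤ κ * ‖v‖)
    {q w : H} (hw : w ∈ T q) :
    Metric.infDist q {q | (0 : H) ∈ T q} ≤ r ∨ r ≤ κ * ‖w‖ := by
  set S : Set H := {q | (0 : H) ∈ T q} with hS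
  by_contra! hcon
  obtain ⟨hfar, hsmall⟩ := hcon
  -- With this base point, `q` is the resolvent for `t = 1`, so the curve `t ↦ (J t).1` below starts
  -- at `q`.
  set p := q + w with hp
  have hex : ∀ t : ℝ, ∃ qv : H × H, 0 < t → qv.2 ∈ T qv.1 ∧ qv.1 + t • qv.2 = p := by
    intro t
    by_cases ht : 0 < t
    · obtain ⟨q, v, hv, h⟩ := surj p t ht
      exact ⟨(q, v), fun _ => ⟨hv, h⟩⟩
    · exact ⟨0, fun h => absurd h ht⟩
  choose J hJ using hex
  have hJ1 : ∀ t, 0 < t → (J t).1 = p - t • (J t).2 := fun t ht =>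
    eq_sub_of_add_eq (hJ t ht).2
  have cmp : ∀ s t, 1 ≤ s → s ≤ t →
      ‖(J t).2‖ ≤ ‖(J s).2‖ ∧ ‖(J s).2 - (J t).2‖ ≤ (t - s) * ‖(J t).2‖ := by
    intro s t hs hst
    refine resolvent_compare hs hst ?_
    have := mono _ _ _ _ (hJ s (by linarith)).1 (hJ t (by linarith)).1
    rw [hJ1 s (by linarith), hJ1 t (by linarith)] at this
    simpa using this
  have hstart : (J 1).2 = w := by
    have := mono _ _ _ _ (hJ 1 one_pos).1 hw
    have e : (J 1).1 - q = -((J 1).2 - w) := by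
      rw [hJ1 1 one_pos, hp]; module
    rw [e, inner_neg_right, real_inner_self_eq_norm_sq] at this
    have : ‖(J 1).2 - w‖ = 0 := by nlinarith [sq_nonneg ‖(J 1).2 - w‖]
    simpa [sub_eq_zero] using this
  have hstart' : (J 1).1 = q := by rw [hJ1 1 one_pos, hstart, hp]; module
  have hbd : ∀ t, 1 ≤ t → ‖(J t).2‖ ≤ ‖w‖ := fun t ht => hstart ▸ (cmp 1 t le_rfl ht).1
  -- The comparison of resolvents makes the operator values Lipschitz in `t`, with constant `‖w‖`;
  -- continuity of the curve is what the intermediate value argument needs.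
  have hcontV : ContinuousOn (fun t => (J t).2) (Set.Ici 1) := by
    have : LipschitzOnWith ‖w‖₊ (fun t => (J t).2) (Set.Ici 1) := by
      refine LipschitzOnWith.of_dist_le_mul fun s hs t ht => ?_
      rw [dist_eq_norm, Real.dist_eq, coe_nnnorm]
      rcases le_total s t with h | h
      · rw [abs_sub_comm, abs_of_nonneg (sub_nonneg.2 h), mul_comm]
        exact (cmp s t hs h).2.trans
          (mul_le_mul_of_nonneg_left (hbd t ht) (sub_nonneg.2 h))
      · rw [abs_of_nonneg (sub_nonneg.2 h), mul_comm, norm_sub_rev]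
        exact (cmp t s ht h).2.trans
          (mul_le_mul_of_nonneg_left (hbd s hs) (sub_nonneg.2 h))
    exact this.continuousOn
  have hcont : ContinuousOn (fun t => Metric.infDist (J t).1 S) (Set.Ici 1) := by
    refine (Metric.continuous_infDist_pt S).comp_continuousOn ?_
    have : ContinuousOn (fun t : ℝ => p - t • (J t).2) (Set.Ici 1) :=
      continuousOn_const.sub (continuousOn_id.smul hcontV)
    exact this.congr fun t ht => hJ1 t (by have : (1 : ℝ) ≤ t := ht; linarith)
  obtain ⟨s, hs⟩ := hne
  have hball : ∀ t, 1 ≤ t → ‖(J t).1 - s‖ ≤ ‖p - s‖ := by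
    intro t ht
    have ht0 : 0 < t := by linarith
    have h1 := mono _ _ _ _ (hJ t ht0).1 hs
    rw [sub_zero] at h1
    have h2 : p - s = ((J t).1 - s) + t • (J t).2 := by rw [← (hJ t ht0).2]; abel
    have h3 : ‖(J t).1 - s‖ ^ 2 ≤ ‖p - s‖ ^ 2 := by
      rw [h2, norm_add_sq_real, inner_smul_right, real_inner_comm]
      nlinarith [sq_nonneg ‖t • (J t).2‖, mul_nonneg ht0.le h1]
    exact (sq_le_sq₀ (norm_nonneg _) (norm_nonneg _)).1 h3
  set u : ℕ → ℝ := fun k => (k : ℝ) + 1 with hu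
  have hu1 : ∀ k, 1 ≤ u k := fun k => by simp [hu]
  obtain ⟨a, -, φ, hφ, hlim⟩ := (isCompact_closedBall s ‖p - s‖).tendsto_subseq
    (x := fun k => (J (u k)).1) fun k => by
      rw [Metric.mem_closedBall, dist_eq_norm]; exact hball _ (hu1 k)
  -- `t • (J t).2 = p - (J t).1` stays bounded, because no resolvent of `p` is farther from the zero
  -- `s` than `p` is.
  have hV0 : Tendsto (fun k => (J (u k)).2) atTop (𝓝 0) := by
    have hle : ∀ k, ‖(J (u k)).2‖ ≤ (2 * ‖p - s‖) * (1 / ((k : ℝ) + 1)) := by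
      intro k
      have hk0 : 0 < u k := by linarith [hu1 k]
      have h1 : ‖u k • (J (u k)).2‖ ≤ 2 * ‖p - s‖ := by
        have : u k • (J (u k)).2 = (p - s) - ((J (u k)).1 - s) := by
          rw [hJ1 _ hk0]; abel
        rw [this]
        linarith [norm_sub_le (p - s) ((J (u k)).1 - s), hball _ (hu1 k)]
      rw [norm_smul, Real.norm_of_nonneg hk0.le] at h1
      rw [mul_one_div, le_div_iff₀ hk0]
      linarith
    refine squeeze_zero_norm hle ?_
    simpa using tendsto_one_div_add_atTop_nhds_zero_nat.const_mul (2 * ‖p - s‖)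
  -- Minty's argument: `(a, 0)` is monotonically related to the whole graph by passing to the limit,
  -- and the resolvent of `a` then has value `0`, hence equals `a`.
  have ha : a ∈ S := by
    have hvar : ∀ q v, v ∈ T q → 0 ≤ inner ℝ v (q - a) := by
      intro q v hv
      have h1 : Tendsto (fun k => inner ℝ (v - (J (u (φ k))).2) (q - (J (u (φ k))).1)) atTop
          (𝓝 (inner ℝ (v - 0) (q - a))) :=
        (tendsto_const_nhds.sub (hV0.comp hφ.tendsto_atTop)).inner
          (tendsto_const_nhds.sub hlim)
      rw [sub_zero] at h1
      exact ge_of_tendsto' h1 fun k =>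
        mono _ _ _ _ hv (hJ _ (by linarith [hu1 (φ k)])).1
    obtain ⟨q', v', hv', hq'⟩ := surj a 1 one_pos
    have h1 := hvar _ _ hv'
    have h2 : q' - a = -v' := by rw [← hq']; module
    rw [h2, inner_neg_right, real_inner_self_eq_norm_sq] at h1
    have h3 : v' = 0 := by
      have : ‖v'‖ = 0 := by nlinarith [sq_nonneg ‖v'‖]
      simpa using this
    subst h3
    have : q' = a := by simpa using hq'
    exact this ▸ hv'
  obtain ⟨k, hk⟩ := (Metric.tendsto_nhds.1 hlim r hr).exists
  have hk' : Metric.infDist (J (u (φ k))).1 S < r :=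
    (Metric.infDist_le_dist_of_mem ha).trans_lt hk
  -- The distance exceeds `r` at `t = 1` and is below `r` at `t = u (φ k)`. Where it equals `r` the
  -- error bound applies, and the operator value there is no larger than `‖w‖`.
  have hivt := intermediate_value_Icc' (hu1 (φ k))
    (hcont.mono (Set.Icc_subset_Ici_self))
  obtain ⟨t, ht, htr⟩ := hivt (show r ∈ _ from ⟨hk'.le, by rw [hstart']; exact hfar.le⟩)
  have h1 := herr _ htr.le _ (hJ t (by linarith [ht.1])).1
  have htr' : Metric.infDist (J t).1 S = r := htr
  rw [htr'] at h1
  exact absurd (h1.trans (mul_le_mul_of_nonneg_left (hbd t ht.1) hκ)) (not_le.2 hsmall)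

end Monotone

/-! ### Linear maps, the box and the function `g` -/

lemma mulE_eq {p q : ℕ} (M : Matrix (Fin p) (Fin q) ℝ) (x : E q) :
    mulE M x = Matrix.toLpLin 2 2 M x := rfl

lemma mulE_sub {p q : ℕ} (M : Matrix (Fin p) (Fin q) ℝ) (x y : E q) :
    mulE M (x - y) = mulE M x - mulE M y := by simp only [mulE_eq, map_sub]

lemma mulE_add {p q : ℕ} (M : Matrix (Fin p) (Fin q) ℝ) (x y : E q) :
    mulE M (x + y) = mulE M x + mulE M y := by simp only [mulE_eq, map_add]

lemma mulE_smul {p q : ℕ} (M : Matrix (Fin p) (Fin q) ℝ) (a : ℝ) (x : E q) :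
    mulE M (a • x) = a • mulE M x := by simp only [mulE_eq, map_smul]

lemma continuous_mulE {p q : ℕ} (M : Matrix (Fin p) (Fin q) ℝ) : Continuous (mulE M) :=
  (Matrix.toLpLin 2 2 M).continuous_of_finiteDimensional

lemma inner_mulE_transpose {p q : ℕ} (M : Matrix (Fin p) (Fin q) ℝ) (y : E p) (x : E q) :
    inner ℝ (mulE M.transpose y) x = inner ℝ y (mulE M x) := by
  simp only [mulE, EuclideanSpace.inner_eq_star_dotProduct, star_trivial]
  rw [Matrix.mulVec_transpose, dotProduct_comm, ← Matrix.dotProduct_mulVec, dotProduct_comm]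

namespace Problem

variable {n m : ℕ} (P : Problem n m)

lemma inner_Q_comm (x y : E n) : inner ℝ (mulE P.Q x) y = inner ℝ (mulE P.Q y) x := by
  have h : P.Q.transpose = P.Q := by
    simpa [Matrix.IsHermitian, Matrix.conjTranspose_eq_transpose_of_trivial] using
      P.Q_psd.isHermitian
  conv_lhs => rw [← h]
  rw [inner_mulE_transpose, real_inner_comm]

lemma inner_Q_nonneg (x : E n) : 0 ≤ inner ℝ (mulE P.Q x) x := by
  have := P.Q_psd.dotProduct_mulVec_nonneg x.ofLp
  simpa [mulE, EuclideanSpace.inner_eq_star_dotProduct] using this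

lemma K_eq : P.K = ⋂ i, {x : E n | P.l i ≤ ((x i : ℝ) : EReal)} ∩
    {x : E n | ((x i : ℝ) : EReal) ≤ P.u i} := by
  ext x; simp [K]

lemma isClosed_K : IsClosed P.K := by
  rw [K_eq]
  refine isClosed_iInter fun i => ?_
  have h : Continuous fun x : E n => ((x i : ℝ) : EReal) :=
    continuous_coe_real_ereal.comp (by fun_prop)
  exact (isClosed_le continuous_const h).inter (isClosed_le h continuous_const)

lemma convex_K : Convex ℝ P.K := by
  intro x hx y hy a b ha hb hab i
  have hxi := hx i
  have hyi := hy i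
  have e : (a • x + b • y) i = a * x i + b * y i := by simp
  have h1 : min (x i) (y i) ≤ a * x i + b * y i := by
    have := mul_le_mul_of_nonneg_left (min_le_left (x i) (y i)) ha
    have := mul_le_mul_of_nonneg_left (min_le_right (x i) (y i)) hb
    have := congrArg (· * min (x i) (y i)) hab
    simp only [add_mul, one_mul] at this
    linarith
  have h2 : a * x i + b * y i ≤ max (x i) (y i) := by
    have := mul_le_mul_of_nonneg_left (le_max_left (x i) (y i)) ha
    have := mul_le_mul_of_nonneg_left (le_max_right (x i) (y i)) hb
    have := congrArg (· * max (x i) (y i)) hab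
    simp only [add_mul, one_mul] at this
    linarith
  rw [e]
  constructor
  · refine le_trans ?_ (EReal.coe_le_coe_iff.2 h1)
    rcases min_choice (x i) (y i) with h | h <;> rw [h]
    exacts [hxi.1, hyi.1]
  · refine le_trans (EReal.coe_le_coe_iff.2 h2) ?_
    rcases max_choice (x i) (y i) with h | h <;> rw [h]
    exacts [hxi.2, hyi.2]

/-- The projection onto the box is characterised by its variational inequality. -/
lemma proj_K_spec (hK : P.K.Nonempty) (q : E n) :
    proj P.K q ∈ P.K ∧ (∀ v ∈ P.K, inner ℝ (q - proj P.K q) (v - proj P.K q) ≤ 0) ∧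
      ∀ v ∈ P.K, ‖q - proj P.K q‖ ≤ ‖q - v‖ := by
  have hbd : ∀ w : E n, BddBelow (Set.range fun v : P.K => ‖q - v‖) := fun w =>
    ⟨0, Set.forall_mem_range.2 fun _ => norm_nonneg _⟩
  have hex : ∃ w, w ∈ P.K ∧ ∀ v ∈ P.K, ‖q - w‖ ≤ ‖q - v‖ := by
    obtain ⟨w, hw, h⟩ :=
      exists_norm_eq_iInf_of_complete_convex hK P.isClosed_K.isComplete P.convex_K q
    exact ⟨w, hw, fun v hv => h ▸ ciInf_le (hbd w) ⟨v, hv⟩⟩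
  have hsp := Classical.epsilon_spec hex
  change proj P.K q ∈ P.K ∧ _ at hsp
  refine ⟨hsp.1, ?_, hsp.2⟩
  refine (norm_eq_iInf_iff_real_inner_le_zero P.convex_K hsp.1).1 ?_
  have : Nonempty P.K := hK.to_subtype
  exact le_antisymm (le_ciInf fun v => hsp.2 v v.2) (ciInf_le (hbd q) ⟨_, hsp.1⟩)

lemma mem_subdifferential_indicator {z x : E n} :
    z ∈ subdifferential (indicatorFn P.K) x ↔
      x ∈ P.K ∧ ∀ v ∈ P.K, inner ℝ z (v - x) ≤ 0 := by
  unfold subdifferential indicatorFn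
  constructor
  · rintro ⟨h1, h2⟩
    have hx : x ∈ P.K := by
      by_contra hx
      simp [hx] at h1
    refine ⟨hx, fun v hv => ?_⟩
    have := h2 v
    simp only [hx, hv, if_true, zero_add] at this
    exact_mod_cast this
  · rintro ⟨hx, h⟩
    refine ⟨by simp [hx], fun v => ?_⟩
    by_cases hv : v ∈ P.K
    · simp only [hx, hv, if_true, zero_add]
      exact_mod_cast h v hv
    · simp [hv]

/-- `g` as a real-valued function. -/
noncomputable def gReal (x : E n) : ℝ := ∑ i, |mulE P.D x i|

lemma mem_subdifferential_g {s x : E n} :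
    s ∈ subdifferential P.g x ↔ ∀ v, P.gReal x + inner ℝ s (v - x) ≤ P.gReal v := by
  unfold subdifferential g
  simp only [Set.mem_ofPred_eq, ne_eq, EReal.coe_ne_top, not_false_eq_true, true_and]
  exact forall_congr' fun v => by rw [← EReal.coe_add, EReal.coe_le_coe_iff]; rfl

lemma gReal_nonneg (x : E n) : 0 ≤ P.gReal x := Finset.sum_nonneg fun _ _ => abs_nonneg _

lemma continuous_gReal : Continuous P.gReal := by
  have := continuous_mulE P.D
  unfold gReal
  fun_prop

lemma gReal_segment_le (x v : E n) {t : ℝ} (h0 : 0 ≤ t) (h1 : t ≤ 1) :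
    P.gReal (x + t • (v - x)) ≤ P.gReal x + t * (P.gReal v - P.gReal x) := by
  have e : P.gReal x + t * (P.gReal v - P.gReal x)
      = ∑ i, ((1 - t) * |mulE P.D x i| + t * |mulE P.D v i|) := by
    rw [Finset.sum_add_distrib, ← Finset.mul_sum, ← Finset.mul_sum]
    unfold gReal; ring
  rw [e]
  refine Finset.sum_le_sum fun i _ => ?_
  have : mulE P.D (x + t • (v - x)) i = (1 - t) * mulE P.D x i + t * mulE P.D v i := by
    rw [mulE_add, mulE_smul, mulE_sub]; simp; ring
  rw [this]
  refine (abs_add_le _ _).trans (le_of_eq ?_)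
  rw [abs_mul, abs_mul, abs_of_nonneg h0, abs_of_nonneg (sub_nonneg.2 h1)]

lemma isClosed_subdifferential_g (x : E n) : IsClosed (subdifferential P.g x) := by
  have : subdifferential P.g x
      = ⋂ v, {s | P.gReal x + inner ℝ s (v - x) ≤ P.gReal v} := by
    ext s; simp [mem_subdifferential_g]
  rw [this]
  exact isClosed_iInter fun v => isClosed_le (by fun_prop) continuous_const

/-! ### Monotonicity -/

/-- The Euclidean inner product of triples. -/
noncomputable def innerT (p q : Triple n m) : ℝ :=
  inner ℝ p.1 q.1 + inner ℝ p.2.1 q.2.1 + inner ℝ p.2.2 q.2.2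

/-- The coupling through `A` is skew and cancels. The `x`–`z` coupling combines with the third block
into monotonicity of the normal cone at the shifted points `x + w₃`. What remains is the quadratic
form of `Q` and monotonicity of the subdifferential of `g`. -/
lemma T_monotone {p w p' w' : Triple n m} (h : w ∈ P.T p) (h' : w' ∈ P.T p') :
    0 ≤ innerT (w - w') (p - p') := by
  obtain ⟨⟨s, hs, h1⟩, h2, h3⟩ := h
  obtain ⟨⟨s', hs', h1'⟩, h2', h3'⟩ := h'
  rw [mem_subdifferential_g] at hs hs'
  rw [mem_subdifferential_indicator] at h3 h3'
  have a1 := hs p'.1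
  have a2 := hs' p.1
  have b1 := h3.2 _ h3'.1
  have b2 := h3'.2 _ h3.1
  have c1 := P.inner_Q_nonneg (p.1 - p'.1)
  have c2 := inner_mulE_transpose P.A (p.2.1 - p'.2.1) (p.1 - p'.1)
  simp only [innerT, Prod.fst_sub, Prod.snd_sub, h1, h1', h2, h2']
  simp only [mulE_sub, inner_sub_left, inner_sub_right, inner_add_left, inner_add_right,
    real_inner_comm] at *
  have r1 := real_inner_comm (mulE P.A p.1) p.2.1
  have r2 := real_inner_comm (mulE P.A p.1) p'.2.1
  have r3 := real_inner_comm (mulE P.A p'.1) p.2.1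
  have r4 := real_inner_comm (mulE P.A p'.1) p'.2.1
  have r5 := real_inner_comm w.2.2 p.2.2
  have r6 := real_inner_comm w.2.2 p'.2.2
  have r7 := real_inner_comm w'.2.2 p.2.2
  have r8 := real_inner_comm w'.2.2 p'.2.2
  linarith

end Problem

/-! ### Existence of proximal points -/

/-- Fermat's rule for a sum `h + g` with `g` convex and `h` quadratically majorised at `x`. -/
lemma Problem.neg_mem_subdifferential_g {n m : ℕ} (P : Problem n m) {h : E n → ℝ} {x G : E n}
    {L : ℝ} (hmin : ∀ v, h x + P.gReal x ≤ h v + P.gReal v)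
    (hmaj : ∀ d, h (x + d) ≤ h x + inner ℝ G d + L * ‖d‖ ^ 2) :
    -G ∈ subdifferential P.g x := by
  rw [P.mem_subdifferential_g]
  intro v
  set d := v - x with hd
  -- Minimality is tested on the segment towards `v` and divided by `t`; the quadratic remainder
  -- vanishes as `t → 0⁺`.
  have key : ∀ t : ℝ, 0 < t → t ≤ 1 →
      0 ≤ (P.gReal v - P.gReal x) + inner ℝ G d + t * (L * ‖d‖ ^ 2) := by
    intro t h0 h1
    have a1 := hmin (x + t • d)
    have a2 := hmaj (t • d)
    have a3 := P.gReal_segment_le x v h0.le h1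
    rw [← hd] at a3
    rw [inner_smul_right, norm_smul, Real.norm_of_nonneg h0.le] at a2
    refine le_of_mul_le_mul_left ?_ h0
    nlinarith
  have hlim : Tendsto (fun t : ℝ => (P.gReal v - P.gReal x) + inner ℝ G d + t * (L * ‖d‖ ^ 2))
      (𝓝[>] 0) (𝓝 ((P.gReal v - P.gReal x) + inner ℝ G d + 0 * (L * ‖d‖ ^ 2))) := by
    refine Tendsto.mono_left (Continuous.tendsto ?_ 0) nhdsWithin_le_nhds
    fun_prop
  have := ge_of_tendsto hlim (by
    filter_upwards [Ioc_mem_nhdsGT one_pos] with t ht using key t ht.1 ht.2)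
  rw [inner_neg_left]
  linarith

lemma exists_norm_mulE_le {p q : ℕ} (M : Matrix (Fin p) (Fin q) ℝ) :
    ∃ C : ℝ, ∀ d, ‖mulE M d‖ ≤ C * ‖d‖ :=
  ⟨‖LinearMap.toContinuousLinearMap (Matrix.toLpLin 2 2 M)‖, fun d =>
    (LinearMap.toContinuousLinearMap (Matrix.toLpLin 2 2 M)).le_opNorm d⟩

lemma isBounded_quadratic_sublevel {n : ℕ} (c a : E n) {t : ℝ} (ht : 0 < t) (M : ℝ) :
    Bornology.IsBounded {x : E n | inner ℝ c x + t * ‖x - a‖ ^ 2 ≤ M} := by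
  set N := M - inner ℝ c a with hN
  refine (Metric.isBounded_closedBall (x := a) (r := (‖c‖ + |N|) / t + 1)).subset fun x hx => ?_
  rw [Metric.mem_closedBall, dist_eq_norm]
  have hx' : inner ℝ c x + t * ‖x - a‖ ^ 2 ≤ M := hx
  have h1 : inner ℝ c x = inner ℝ c a + inner ℝ c (x - a) := by rw [← inner_add_right]; simp
  have h2 := (abs_le.1 (abs_real_inner_le_norm c (x - a))).1
  have h3 := le_abs_self N
  by_contra! hcon
  set y := ‖x - a‖
  have h4 : (‖c‖ + |N|) < t * (y - 1) := by
    rw [mul_comm, ← div_lt_iff₀ ht]; linarith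
  have h5 : 1 ≤ y := by
    have : 0 ≤ (‖c‖ + |N|) / t := by positivity
    linarith
  nlinarith [norm_nonneg c, abs_nonneg N,
    mul_le_mul_of_nonneg_right h4.le (by linarith : 0 ≤ y),
    mul_nonneg (abs_nonneg N) (by linarith : 0 ≤ y - 1)]

/-- The proximal point of `T_ℓ` exists, with weight `τ` in the first block. -/
theorem Problem.exists_proximal_point {n m : ℕ} (P : Problem n m) (hK : P.K.Nonempty)
    {τ β : ℝ} (hτ : 0 < τ) (hβ : 0 < β) (p : Triple n m) :
    ∃ q, ∃ w ∈ P.T q, τ • (q.1 - p.1) + β • w.1 = 0 ∧ (q.2.1 - p.2.1) + β • w.2.1 = 0 ∧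
      (q.2.2 - p.2.2) + β • w.2.2 = 0 := by
  obtain ⟨xk, yk, zk⟩ := p
  have hβ' : β ≠ 0 := hβ.ne'
  set t := τ / β with ht
  have ht0 : 0 < t := div_pos hτ hβ
  let a : E n → E m := fun x => mulE P.A x - P.b - β⁻¹ • yk
  let qq : E n → E n := fun x => β⁻¹ • zk + x
  -- The proximal augmented Lagrangian without `g`: eliminating `y` and `z` from the proximal
  -- equations leaves the optimality condition for minimising `h + g` over `x`. The last term makes
  -- the sublevel sets bounded.
  let h : E n → ℝ := fun x => inner ℝ P.c x + inner ℝ (mulE P.Q x) x / 2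
    + β / 2 * ‖a x‖ ^ 2 + β / 2 * (Metric.infDist (qq x) P.K) ^ 2 + t / 2 * ‖x - xk‖ ^ 2
  have hQc := continuous_mulE P.Q
  have hAc := continuous_mulE P.A
  have hgc := P.continuous_gReal
  have hcont : Continuous fun x => h x + P.gReal x := by
    have : Continuous fun x => Metric.infDist (qq x) P.K :=
      (Metric.continuous_infDist_pt P.K).comp (by fun_prop)
    fun_prop
  obtain ⟨x, hx⟩ : ∃ x, ∀ v, h x + P.gReal x ≤ h v + P.gReal v := by
    refine Continuous.exists_forall_le_of_isBounded hcont 0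
      ((isBounded_quadratic_sublevel P.c xk (half_pos ht0) (h 0 + P.gReal 0)).subset
        fun v hv => ?_)
    refine le_trans ?_ (show h v + P.gReal v ≤ _ from hv)
    have h1 := P.inner_Q_nonneg v
    have h2 := P.gReal_nonneg v
    have h3 : 0 ≤ β / 2 * ‖a v‖ ^ 2 := by positivity
    have h4 : 0 ≤ β / 2 * (Metric.infDist (qq v) P.K) ^ 2 := by positivity
    simp only [h]
    linarith
  obtain ⟨hmem, hvar, hnear⟩ := P.proj_K_spec hK (qq x)
  set π := proj P.K (qq x) with hπ
  set z := β • (qq x - π) with hz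
  set y := -β • a x with hy
  have hinf : Metric.infDist (qq x) P.K = ‖qq x - π‖ := by
    refine le_antisymm ((Metric.infDist_le_dist_of_mem hmem).trans_eq (dist_eq_norm _ _)) ?_
    exact (Metric.le_infDist hK).2 fun {v} hv => (hnear v hv).trans_eq (dist_eq_norm _ _).symm
  obtain ⟨CQ, hCQ⟩ := exists_norm_mulE_le P.Q
  obtain ⟨CA, hCA⟩ := exists_norm_mulE_le P.A
  set G : E n := P.c + mulE P.Q x - mulE P.A.transpose y + z + t • (x - xk) with hG
  have hmaj : ∀ d, h (x + d) ≤ h x + inner ℝ G d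
      + (CQ / 2 + β / 2 * CA ^ 2 + β / 2 + t / 2) * ‖d‖ ^ 2 := by
    intro d
    have e1 : inner ℝ (mulE P.Q (x + d)) (x + d) = inner ℝ (mulE P.Q x) x
        + 2 * inner ℝ (mulE P.Q x) d + inner ℝ (mulE P.Q d) d := by
      rw [mulE_add, inner_add_left, inner_add_right, inner_add_right, P.inner_Q_comm d x]; ring
    have e1' : inner ℝ (mulE P.Q d) d ≤ CQ * ‖d‖ ^ 2 := by
      refine (real_inner_le_norm _ _).trans ?_
      rw [pow_two, ← mul_assoc]
      exact mul_le_mul_of_nonneg_right (hCQ d) (norm_nonneg d)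
    have e2 : ‖a (x + d)‖ ^ 2 = ‖a x‖ ^ 2 + 2 * inner ℝ (a x) (mulE P.A d)
        + ‖mulE P.A d‖ ^ 2 := by
      rw [← norm_add_sq_real]; simp only [a, mulE_add]; congr 2; abel
    have e2' : ‖mulE P.A d‖ ^ 2 ≤ CA ^ 2 * ‖d‖ ^ 2 := by
      rw [← mul_pow]; exact pow_le_pow_left₀ (norm_nonneg _) (hCA d) 2
    -- Keeping the projection `π` of the unperturbed point fixed bounds the squared distance by a
    -- quadratic, so its differentiability is not needed.
    have e3 : (Metric.infDist (qq (x + d)) P.K) ^ 2 ≤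
        ‖qq x - π‖ ^ 2 + 2 * inner ℝ (qq x - π) d + ‖d‖ ^ 2 := by
      rw [← norm_add_sq_real]
      refine pow_le_pow_left₀ Metric.infDist_nonneg ?_ 2
      refine (Metric.infDist_le_dist_of_mem hmem).trans_eq ?_
      rw [dist_eq_norm]; simp only [qq]; congr 1; abel
    have e4 : ‖x + d - xk‖ ^ 2 = ‖x - xk‖ ^ 2 + 2 * inner ℝ (x - xk) d + ‖d‖ ^ 2 := by
      rw [← norm_add_sq_real]; congr 2; abel
    have e5 : inner ℝ G d = inner ℝ P.c d + inner ℝ (mulE P.Q x) d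
        + β * inner ℝ (a x) (mulE P.A d) + β * inner ℝ (qq x - π) d
        + t * inner ℝ (x - xk) d := by
      rw [hG, inner_add_left, inner_add_left, inner_sub_left, inner_add_left,
        inner_mulE_transpose, hy, hz, real_inner_smul_left, real_inner_smul_left,
        real_inner_smul_left]
      ring
    have e2b := mul_le_mul_of_nonneg_left e2' (half_pos hβ).le
    have e3b := mul_le_mul_of_nonneg_left e3 (half_pos hβ).le
    simp only [h, e1, e2, e4, e5, inner_add_right, hinf]
    linarith
  have hsub := P.neg_mem_subdifferential_g hx hmaj
  refine ⟨(x, y, z), (-t • (x - xk), mulE P.A x - P.b, π - x), ⟨⟨-G, hsub, ?_⟩, rfl, ?_⟩,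
    ?_, ?_, ?_⟩
  · simp only [hG]; module
  · rw [P.mem_subdifferential_indicator]
    have : x + (π - x) = π := by abel
    simp only [this]
    refine ⟨hmem, fun v hv => ?_⟩
    rw [hz, real_inner_smul_left]
    exact mul_nonpos_of_nonneg_of_nonpos hβ.le (hvar v hv)
  · have : β * t = τ := by rw [ht]; field_simp
    simp only [smul_smul, mul_neg, this]; module
  · simp only [hy, a, smul_sub, smul_smul, neg_mul, mul_inv_cancel₀ hβ']; simp
  · simp only [hz, qq, smul_sub, smul_add, smul_smul, mul_inv_cancel₀ hβ']; module

/-! ### Weighted norms and distances -/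

variable {n m : ℕ}

/-- The isometric copy of the triples, scaled by `√τ` in the first block. -/
noncomputable def scaled (τ : ℝ) (p : Triple n m) : WithLp 2 (E n × WithLp 2 (E m × E n)) :=
  WithLp.toLp 2 (Real.sqrt τ • p.1, WithLp.toLp 2 (p.2.1, p.2.2))

lemma scaled_sub (τ : ℝ) (p q : Triple n m) : scaled τ (p - q) = scaled τ p - scaled τ q := by
  simp only [scaled, Prod.fst_sub, Prod.snd_sub, smul_sub]; rfl

lemma scaled_add (τ : ℝ) (p q : Triple n m) : scaled τ (p + q) = scaled τ p + scaled τ q := by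
  simp only [scaled, Prod.fst_add, Prod.snd_add, smul_add]; rfl

lemma norm_scaled {τ : ℝ} (hτ : 0 ≤ τ) (p : Triple n m) : ‖scaled τ p‖ = normR τ p := by
  rw [WithLp.prod_norm_eq_of_L2, WithLp.prod_norm_sq_eq_of_L2]
  change Real.sqrt (‖Real.sqrt τ • p.1‖ ^ 2 + (‖p.2.1‖ ^ 2 + ‖p.2.2‖ ^ 2)) = _
  simp only [normR, norm_smul, mul_pow, Real.norm_of_nonneg (Real.sqrt_nonneg τ),
    Real.sq_sqrt hτ, add_assoc]

lemma normR_nonneg (τ : ℝ) (p : Triple n m) : 0 ≤ normR τ p := Real.sqrt_nonneg _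

lemma normR_sq {τ : ℝ} (hτ : 0 ≤ τ) (p : Triple n m) :
    normR τ p ^ 2 = τ * ‖p.1‖ ^ 2 + ‖p.2.1‖ ^ 2 + ‖p.2.2‖ ^ 2 :=
  Real.sq_sqrt (by positivity)

lemma normR_add_le {τ : ℝ} (hτ : 0 ≤ τ) (p q : Triple n m) :
    normR τ (p + q) ≤ normR τ p + normR τ q := by
  simp only [← norm_scaled hτ, scaled_add]; exact norm_add_le _ _

lemma normR_sub_comm {τ : ℝ} (hτ : 0 ≤ τ) (p q : Triple n m) :
    normR τ (p - q) = normR τ (q - p) := by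
  simp only [← norm_scaled hτ, scaled_sub]; exact norm_sub_rev _ _

lemma inner_scaled_one (p q : Triple n m) :
    inner ℝ (scaled 1 p) (scaled 1 q) = Problem.innerT p q := by
  simp [scaled, Problem.innerT, WithLp.prod_inner_apply, add_assoc]

lemma scaled_one_surjective : Function.Surjective (scaled (n := n) (m := m) 1) := fun h =>
  ⟨(h.fst, h.snd.fst, h.snd.snd), by simp only [scaled, Real.sqrt_one, one_smul]; rfl⟩

lemma scaled_one_injective : Function.Injective (scaled (n := n) (m := m) 1) := by
  intro p q h
  have h1 := congrArg (fun h => h.fst) h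
  have h2 := congrArg (fun h => h.snd.fst) h
  have h3 := congrArg (fun h => h.snd.snd) h
  simp only [scaled, Real.sqrt_one, one_smul] at h1 h2 h3
  exact Prod.ext h1 (Prod.ext h2 h3)

/-- The weighted distance as a real number. -/
noncomputable def rdist (τ : ℝ) (p : Triple n m) (S : Set (Triple n m)) : ℝ :=
  Metric.infDist (scaled τ p) (scaled τ '' S)

section rdist

variable {τ : ℝ} {S : Set (Triple n m)}

lemma rdist_nonneg (p : Triple n m) : 0 ≤ rdist τ p S := Metric.infDist_nonneg

lemma distR_eq_ofReal (hτ : 0 ≤ τ) (hS : S.Nonempty) (p : Triple n m) :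
    distR τ p S = ENNReal.ofReal (rdist τ p S) := by
  rw [rdist, Metric.infDist, ENNReal.ofReal_toReal (Metric.infEDist_ne_top (hS.image _)),
    Metric.infEDist, iInf_image]
  simp only [distR, edist_dist, dist_eq_norm, ← scaled_sub, norm_scaled hτ]

lemma rdist_le (hτ : 0 ≤ τ) {p q : Triple n m} (hq : q ∈ S) :
    rdist τ p S ≤ normR τ (p - q) := by
  rw [← norm_scaled hτ, scaled_sub, ← dist_eq_norm]
  exact Metric.infDist_le_dist_of_mem (Set.mem_image_of_mem _ hq)

lemma le_rdist (hτ : 0 ≤ τ) (hS : S.Nonempty) {p : Triple n m} {a : ℝ}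
    (h : ∀ q ∈ S, a ≤ normR τ (p - q)) : a ≤ rdist τ p S := by
  refine (Metric.le_infDist (hS.image _)).2 ?_
  rintro _ ⟨q, hq, rfl⟩
  rw [dist_eq_norm, ← scaled_sub, norm_scaled hτ]
  exact h q hq

lemma rdist_le_add (hτ : 0 ≤ τ) (p q : Triple n m) :
    rdist τ p S ≤ normR τ (p - q) + rdist τ q S := by
  rw [← norm_scaled hτ, scaled_sub, ← dist_eq_norm, add_comm]
  exact Metric.infDist_le_infDist_add_dist

lemma rdist_le_mul {τ' C : ℝ} (hτ : 0 ≤ τ) (hτ' : 0 ≤ τ') (hS : S.Nonempty) (hC : 0 < C)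
    (h : ∀ v : Triple n m, normR τ v ≤ C * normR τ' v) (p : Triple n m) :
    rdist τ p S ≤ C * rdist τ' p S := by
  rw [mul_comm, ← div_le_iff₀ hC]
  refine le_rdist hτ' hS fun q hq => ?_
  rw [div_le_iff₀ hC, mul_comm]
  exact (rdist_le hτ hq).trans (h _)

end rdist

lemma normR_mono {τ τ' : ℝ} (h : τ ≤ τ') (v : Triple n m) : normR τ v ≤ normR τ' v := by
  refine Real.sqrt_le_sqrt ?_
  have := mul_le_mul_of_nonneg_right h (sq_nonneg ‖v.1‖)
  linarith

lemma normR_le_sqrt_max (τ : ℝ) (v : Triple n m) :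
    normR τ v ≤ Real.sqrt (max τ 1) * normR 1 v := by
  have h1 : (1 : ℝ) ≤ max τ 1 := le_max_right _ _
  rw [normR, normR, ← Real.sqrt_mul (by linarith)]
  refine Real.sqrt_le_sqrt ?_
  have := mul_le_mul_of_nonneg_right (le_max_left τ 1) (sq_nonneg ‖v.1‖)
  nlinarith [sq_nonneg ‖v.2.1‖, sq_nonneg ‖v.2.2‖]

/-! ### Error bounds for `T_ℓ` -/

/-- Where `T_ℓ` is farther than `r` from its zeros, it is bounded below by `r / κ`. -/
theorem Problem.rdist_le_or_le_mul_normR (P : Problem n m) (hK : P.K.Nonempty)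
    (hS : P.solutionSet.Nonempty) {r κ : ℝ} (hr : 0 < r) (hκ : 0 ≤ κ)
    (herr : ∀ q, rdist 1 q P.solutionSet ≤ r → ∀ w ∈ P.T q,
      rdist 1 q P.solutionSet ≤ κ * normR 1 w)
    {q w : Triple n m} (hw : w ∈ P.T q) :
    rdist 1 q P.solutionSet ≤ r ∨ r ≤ κ * normR 1 w := by
  -- `Triple` carries the sup norm of a product, so `P.T` is transported to the Euclidean product,
  -- where the Hilbert space theorem applies.
  let T' : WithLp 2 (E n × WithLp 2 (E m × E n)) →
      Set (WithLp 2 (E n × WithLp 2 (E m × E n))) :=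
    fun h => {v | ∃ q, ∃ w ∈ P.T q, scaled 1 q = h ∧ scaled 1 w = v}
  have h0 : scaled 1 (0 : Triple n m) = 0 := by simp [scaled]
  have hzero : {h | 0 ∈ T' h} = scaled 1 '' P.solutionSet := by
    ext h
    constructor
    · rintro ⟨q, w, hw, rfl, h2⟩
      refine ⟨q, ?_, rfl⟩
      rw [← h0] at h2
      rw [scaled_one_injective h2] at hw
      exact hw
    · rintro ⟨q, hq, rfl⟩
      exact ⟨q, 0, hq, rfl, h0⟩
  have key := infDist_le_or_le_mul_norm (T := T') (r := r) (κ := κ)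
    (q := scaled 1 q) (w := scaled 1 w) ?_ ?_ ?_ hr hκ ?_ ⟨q, w, hw, rfl, rfl⟩
  · rwa [hzero, norm_scaled zero_le_one] at key
  · rintro _ _ _ _ ⟨q, w, hw, rfl, rfl⟩ ⟨q', w', hw', rfl, rfl⟩
    rw [← scaled_sub, ← scaled_sub, inner_scaled_one]
    exact P.T_monotone hw hw'
  · intro h t ht
    obtain ⟨p, rfl⟩ := scaled_one_surjective h
    obtain ⟨q, w, hw, e1, e2, e3⟩ := P.exists_proximal_point hK one_pos ht p
    refine ⟨_, _, ⟨q, w, hw, rfl, rfl⟩, ?_⟩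
    have : q + t • w = p := by
      refine Prod.ext ?_ (Prod.ext ?_ ?_)
      · rw [one_smul] at e1
        exact sub_eq_zero.1 (by rw [← e1]; simp only [Prod.fst_add, Prod.smul_fst]; abel)
      · exact sub_eq_zero.1 (by
          rw [← e2]; simp only [Prod.snd_add, Prod.fst_add, Prod.smul_snd, Prod.smul_fst]; abel)
      · exact sub_eq_zero.1 (by
          rw [← e3]; simp only [Prod.snd_add, Prod.smul_snd]; abel)
    rw [← this, scaled_add]
    congr 1
    simp only [scaled, Real.sqrt_one, one_smul]; rfl
  · rw [hzero]; exact hS.image _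
  · rw [hzero]
    rintro _ hq _ ⟨q, w, hw, rfl, rfl⟩
    rw [norm_scaled zero_le_one]
    exact herr q hq w hw

/-- The exact proximal step: it is firmly nonexpansive, and contracts the distance to the
solution set. -/
theorem Problem.proximal_step (P : Problem n m) (hK : P.K.Nonempty)
    (hS : P.solutionSet.Nonempty) {r κ : ℝ} (hr : 0 < r) (hκ : 0 < κ)
    (herr : ∀ q, rdist 1 q P.solutionSet ≤ r → ∀ w ∈ P.T q,
      rdist 1 q P.solutionSet ≤ κ * normR 1 w)
    {τ β : ℝ} (hτ : 0 < τ) (hβ : 0 < β) {p q w : Triple n m}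
    (hp : rdist τ p P.solutionSet ≤ r) (hw : w ∈ P.T q)
    (e1 : τ • (q.1 - p.1) + β • w.1 = 0) (e2 : (q.2.1 - p.2.1) + β • w.2.1 = 0)
    (e3 : (q.2.2 - p.2.2) + β • w.2.2 = 0) :
    normR τ (p - q) ≤ rdist τ p P.solutionSet ∧
    rdist τ q P.solutionSet ≤ rdist τ p P.solutionSet ∧
    rdist τ q P.solutionSet ≤ κ * max τ 1 / Real.sqrt (β ^ 2 + κ ^ 2 * (max τ 1) ^ 2)
      * rdist τ p P.solutionSet := by
  set S := P.solutionSet with hSdef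
  have f1 : β • w.1 = τ • (p.1 - q.1) := by
    rw [← sub_eq_zero, ← e1]; module
  have f2 : β • w.2.1 = p.2.1 - q.2.1 := by
    rw [← sub_eq_zero, ← e2]; module
  have f3 : β • w.2.2 = p.2.2 - q.2.2 := by
    rw [← sub_eq_zero, ← e3]; module
  -- Monotonicity between `(q, w)` and `(s, 0)` makes the cross term in the expansion of `‖(p - q) +
  -- (q - s)‖²` nonnegative.
  have hfirm : ∀ s ∈ S, normR τ (q - s) ^ 2 + normR τ (p - q) ^ 2 ≤ normR τ (p - s) ^ 2 := by
    intro s hs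
    have hs' : (0 : Triple n m) ∈ P.T s := hs
    have hm := P.T_monotone hw hs'
    have hm' := mul_nonneg hβ.le hm
    rw [sub_zero] at hm'
    simp only [innerT, mul_add, ← real_inner_smul_left, f1, f2, f3] at hm'
    simp only [normR_sq hτ.le, Prod.fst_sub, Prod.snd_sub] at hm' ⊢
    have g : ∀ {k : ℕ} (a b c : E k), ‖a - c‖ ^ 2
        = ‖a - b‖ ^ 2 + 2 * inner ℝ (a - b) (b - c) + ‖b - c‖ ^ 2 := by
      intro k a b c
      rw [← norm_add_sq_real]; congr 2; abel
    rw [g p.1 q.1 s.1, g p.2.1 q.2.1 s.2.1, g p.2.2 q.2.2 s.2.2]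
    rw [real_inner_smul_left] at hm'
    linarith
  have hsq : rdist τ q S ^ 2 + normR τ (p - q) ^ 2 ≤ rdist τ p S ^ 2 := by
    have : Real.sqrt (rdist τ q S ^ 2 + normR τ (p - q) ^ 2) ≤ rdist τ p S := by
      refine le_rdist hτ.le hS fun s hs => ?_
      rw [Real.sqrt_le_left (normR_nonneg _ _)]
      have := pow_le_pow_left₀ (rdist_nonneg q) (rdist_le hτ.le (p := q) hs) 2
      linarith [hfirm s hs]
    exact (Real.sqrt_le_left (rdist_nonneg p)).1 this
  have hqp : rdist τ q S ≤ rdist τ p S :=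
    (sq_le_sq₀ (rdist_nonneg q) (rdist_nonneg p)).1 (by linarith [sq_nonneg (normR τ (p - q))])
  set γ := max τ 1 with hγ
  have hγ1 : 1 ≤ γ := le_max_right _ _
  have hw1 : β * normR 1 w ≤ Real.sqrt γ * normR τ (p - q) := by
    refine (sq_le_sq₀ (mul_nonneg hβ.le (normR_nonneg _ _))
      (mul_nonneg (Real.sqrt_nonneg _) (normR_nonneg _ _))).1 ?_
    rw [mul_pow, mul_pow, Real.sq_sqrt (by linarith), normR_sq zero_le_one, normR_sq hτ.le]
    have k : ∀ {l : ℕ} (v : E l), β ^ 2 * ‖v‖ ^ 2 = ‖β • v‖ ^ 2 := by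
      intro l v
      rw [norm_smul, mul_pow, Real.norm_of_nonneg hβ.le]
    rw [mul_add, mul_add, one_mul, k, k, k, f1, f2, f3, norm_smul, mul_pow,
      Real.norm_of_nonneg hτ.le, Prod.fst_sub, Prod.snd_sub, Prod.fst_sub, Prod.snd_sub]
    have a1 : τ ^ 2 * ‖p.1 - q.1‖ ^ 2 ≤ γ * (τ * ‖p.1 - q.1‖ ^ 2) := by
      rw [pow_two, mul_assoc]
      exact mul_le_mul_of_nonneg_right (le_max_left _ _) (by positivity)
    nlinarith [sq_nonneg ‖p.2.1 - q.2.1‖, sq_nonneg ‖p.2.2 - q.2.2‖]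
  -- `q` may lie outside the Euclidean `r`-neighbourhood. In that case `r ≤ κ ‖w‖`, while the
  -- `R`-distance of `q` is still at most `r`. The factor `√γ` here and the one in `hw1` multiply to
  -- `γ`.
  have hdw : rdist τ q S ≤ Real.sqrt γ * (κ * normR 1 w) := by
    have hle1 : rdist τ q S ≤ Real.sqrt γ * rdist 1 q S :=
      rdist_le_mul hτ.le zero_le_one hS (Real.sqrt_pos.2 (by linarith)) (normR_le_sqrt_max τ) q
    rcases P.rdist_le_or_le_mul_normR hK hS hr hκ.le herr hw with h | h
    · exact hle1.trans (mul_le_mul_of_nonneg_left (herr q h w hw) (Real.sqrt_nonneg _))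
    · refine (hqp.trans hp).trans (h.trans ?_)
      exact le_mul_of_one_le_left (mul_nonneg hκ.le (normR_nonneg _ _)) (Real.one_le_sqrt.2 hγ1)
  have hbd : β * rdist τ q S ≤ κ * γ * normR τ (p - q) := by
    have h1 := mul_le_mul_of_nonneg_left hdw hβ.le
    have h2 := mul_le_mul_of_nonneg_left hw1 (mul_nonneg (Real.sqrt_nonneg γ) hκ.le)
    have h3 := Real.mul_self_sqrt (by linarith : 0 ≤ γ)
    calc β * rdist τ q S ≤ Real.sqrt γ * κ * (Real.sqrt γ * normR τ (p - q)) := by linarith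
      _ = κ * (Real.sqrt γ * Real.sqrt γ) * normR τ (p - q) := by ring
      _ = _ := by rw [h3]
  refine ⟨(sq_le_sq₀ (normR_nonneg _ _) (rdist_nonneg p)).1
    (by linarith [sq_nonneg (rdist τ q S)]), hqp, ?_⟩
  have hκγ : 0 < κ * γ := mul_pos hκ (by linarith)
  have hpos : 0 < β ^ 2 + κ ^ 2 * γ ^ 2 := by positivity
  rw [div_mul_eq_mul_div, le_div_iff₀ (Real.sqrt_pos.2 hpos)]
  refine (sq_le_sq₀ (mul_nonneg (rdist_nonneg q) (Real.sqrt_nonneg _))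
    (mul_nonneg hκγ.le (rdist_nonneg p))).1 ?_
  rw [mul_pow, Real.sq_sqrt hpos.le]
  have h1 := pow_le_pow_left₀ (mul_nonneg hβ.le (rdist_nonneg q)) hbd 2
  have h2 := mul_le_mul_of_nonneg_left hsq (sq_nonneg (κ * γ))
  linear_combination h1 + h2

/-! ### The inexact step -/

/-- A closed set in finite dimension attains its distance, and the empty set is excluded because its
distance is `⊤`. This turns the stopping criterion into an actual error vector. -/
lemma exists_mem_norm_le_of_distZeroPair_le {S : Set (E n × E m)} (hS : IsClosed S) {ε : ℝ}
    (hε : 0 ≤ ε) (h : distZeroPair S ≤ ENNReal.ofReal ε) :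
    ∃ e ∈ S, ‖e.1‖ ^ 2 + ‖e.2‖ ^ 2 ≤ ε ^ 2 := by
  have hne : S.Nonempty := by
    rw [Set.nonempty_iff_ne_empty]
    rintro rfl
    simp [distZeroPair] at h
  have hcl : IsClosed (WithLp.toLp 2 '' S) := by
    have : WithLp.toLp 2 '' S = WithLp.ofLp ⁻¹' S := by
      ext v
      exact ⟨by rintro ⟨e, he, rfl⟩; exact he, fun hv => ⟨v.ofLp, hv, rfl⟩⟩
    rw [this]
    exact hS.preimage (WithLp.prod_continuous_ofLp 2 _ _)
  obtain ⟨_, ⟨e, he, rfl⟩, hd⟩ := hcl.exists_infDist_eq_dist (hne.image _) 0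
  refine ⟨e, he, ?_⟩
  rw [dist_zero_left, WithLp.prod_norm_eq_of_L2] at hd
  have hle : ENNReal.ofReal (Real.sqrt (‖e.1‖ ^ 2 + ‖e.2‖ ^ 2)) ≤ distZeroPair S := by
    refine le_iInf₂ fun v hv => ENNReal.ofReal_le_ofReal ?_
    have := Metric.infDist_le_dist_of_mem (x := (0 : WithLp 2 (E n × E m)))
      (Set.mem_image_of_mem (WithLp.toLp 2) hv)
    rw [hd, dist_zero_left, WithLp.prod_norm_eq_of_L2] at this
    exact this
  exact (Real.sqrt_le_left hε).1 ((ENNReal.ofReal_le_ofReal_iff hε).1 (hle.trans h))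

lemma Problem.isClosed_F (P : Problem n m) (β ρ : ℝ) (pk : Triple n m) (x : E n) (y : E m) :
    IsClosed (P.F β ρ pk x y) := by
  have : P.F β ρ pk x y = {w | w.1 - P.residual β ρ pk x y ∈ subdifferential P.g x} ∩
      {w | w.2 = mulE P.A x + β⁻¹ • (y - pk.2.1) - P.b} := by
    ext w
    refine and_congr_left fun _ => ⟨?_, fun h => ⟨_, h, by abel⟩⟩
    rintro ⟨s, hs, h⟩
    simpa [h] using hs
  rw [this]
  exact ((P.isClosed_subdifferential_g x).preimage (by fun_prop)).inter
    (isClosed_eq (by fun_prop) continuous_const)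

/-- An approximate solution of the subproblem solves the proximal inclusion up to an error. -/
lemma Problem.exists_mem_T_of_mem_F (P : Problem n m) (hK : P.K.Nonempty) {τ β : ℝ}
    (hβ : 0 < β) {p q : Triple n m} {e : E n × E m}
    (he : e ∈ P.F β (β / τ) p q.1 q.2.1)
    (hz : q.2.2 = (p.2.2 + β • q.1) - β • proj P.K (β⁻¹ • p.2.2 + q.1)) :
    ∃ w ∈ P.T q, τ • (q.1 - p.1) + β • w.1 = β • e.1 ∧
      (q.2.1 - p.2.1) + β • w.2.1 = β • e.2 ∧ (q.2.2 - p.2.2) + β • w.2.2 = 0 := by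
  obtain ⟨⟨s, hs, h1⟩, h2⟩ := he
  obtain ⟨hmem, hvar, -⟩ := P.proj_K_spec hK (β⁻¹ • p.2.2 + q.1)
  set π := proj P.K (β⁻¹ • p.2.2 + q.1) with hπ
  have hβ' := hβ.ne'
  -- The term `ρ⁻¹ (x - x_k)` of the residual is moved out of the error, as `ρ⁻¹ = τ / β`. The third
  -- entry shifts `x` to `π`, where the updated `z` is a normal vector of `K`.
  refine ⟨(e.1 - (τ / β) • (q.1 - p.1), mulE P.A q.1 - P.b, π - q.1), ⟨⟨s, hs, ?_⟩, rfl, ?_⟩,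
    ?_, ?_, ?_⟩
  · rw [h1, residual, ← hπ, inv_div, hz]; module
  · rw [P.mem_subdifferential_indicator]
    have : q.1 + (π - q.1) = π := by abel
    simp only [this]
    refine ⟨hmem, fun v hv => ?_⟩
    have : q.2.2 = β • (β⁻¹ • p.2.2 + q.1 - π) := by
      rw [hz, smul_sub, smul_add, smul_smul, mul_inv_cancel₀ hβ', one_smul]
    rw [this, real_inner_smul_left]
    exact mul_nonpos_of_nonneg_of_nonpos hβ.le (hvar v hv)
  · simp only [smul_sub β, smul_smul, mul_div_cancel₀ τ hβ']; abel
  · rw [h2]; simp only [smul_sub, smul_add, smul_smul, mul_inv_cancel₀ hβ', one_smul]; abel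
  · rw [hz]; module

/-- The distance between approximate and exact proximal points. -/
lemma Problem.normR_sub_proximal_le (P : Problem n m) {τ β ε : ℝ} (hτ : 0 < τ) (hβ : 0 < β)
    (hε : 0 ≤ ε) {p q w q' w' : Triple n m} {e : E n × E m}
    (he : ‖e.1‖ ^ 2 + ‖e.2‖ ^ 2 ≤ ε ^ 2) (hw : w ∈ P.T q) (hw' : w' ∈ P.T q')
    (e1 : τ • (q.1 - p.1) + β • w.1 = 0) (e2 : (q.2.1 - p.2.1) + β • w.2.1 = 0)
    (e3 : (q.2.2 - p.2.2) + β • w.2.2 = 0)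
    (e1' : τ • (q'.1 - p.1) + β • w'.1 = β • e.1)
    (e2' : (q'.2.1 - p.2.1) + β • w'.2.1 = β • e.2)
    (e3' : (q'.2.2 - p.2.2) + β • w'.2.2 = 0) :
    min (Real.sqrt τ) 1 * normR τ (q' - q) ≤ β * ε := by
  have f1 : β • (w'.1 - w.1) = β • e.1 - τ • (q'.1 - q.1) := by
    rw [← e1', ← sub_zero (_ - τ • (q'.1 - q.1)), ← e1]; module
  have f2 : β • (w'.2.1 - w.2.1) = β • e.2 - (q'.2.1 - q.2.1) := by
    rw [← e2', ← sub_zero (_ - (q'.2.1 - q.2.1)), ← e2]; module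
  have f3 : β • (w'.2.2 - w.2.2) = -(q'.2.2 - q.2.2) := by
    rw [← sub_zero (-(q'.2.2 - q.2.2)), ← e3]
    rw [← sub_eq_zero, ← neg_eq_zero, ← sub_eq_zero] at e3'
    rw [← sub_eq_zero, ← neg_zero, ← e3']; module
  -- This gives `N² ≤ β ⟨e, q' - q⟩` over the first two blocks only, since the `z`-update is exact.
  have hm := mul_nonneg hβ.le (P.T_monotone hw' hw)
  simp only [innerT, Prod.fst_sub, Prod.snd_sub, mul_add, ← real_inner_smul_left, f1, f2,
    f3] at hm
  rw [inner_sub_left, inner_sub_left, inner_neg_left, real_inner_smul_left, real_inner_smul_left,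
    real_inner_smul_left, real_inner_self_eq_norm_sq, real_inner_self_eq_norm_sq,
    real_inner_self_eq_norm_sq] at hm
  set N := normR τ (q' - q) with hN
  have hN2 := normR_sq hτ.le (q' - q)
  simp only [Prod.fst_sub, Prod.snd_sub] at hN2
  rw [← hN] at hN2
  have hN0 : 0 ≤ N := normR_nonneg _ _
  set μ := min (Real.sqrt τ) 1 with hμ
  have hμ0 : 0 < μ := lt_min (Real.sqrt_pos.2 hτ) one_pos
  have hμτ : μ ^ 2 ≤ τ := by
    rw [← Real.sq_sqrt hτ.le]; exact pow_le_pow_left₀ hμ0.le (min_le_left _ _) 2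
  have hμ1 : μ ^ 2 ≤ 1 := pow_le_one₀ hμ0.le (min_le_right _ _)
  have c1 := real_inner_le_norm e.1 (q'.1 - q.1)
  have c2 := real_inner_le_norm e.2 (q'.2.1 - q.2.1)
  set a := ‖e.1‖
  set b := ‖e.2‖
  set c := ‖q'.1 - q.1‖
  set d := ‖q'.2.1 - q.2.1‖
  -- Cauchy–Schwarz; the factor `μ = min(√τ, 1)` is the price of measuring the first two blocks of
  -- `q' - q` in the `R`-norm.
  have hX : μ * (a * c + b * d) ≤ ε * N := by
    have hcd : μ ^ 2 * (c ^ 2 + d ^ 2) ≤ N ^ 2 := by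
      have := mul_le_mul_of_nonneg_right hμτ (sq_nonneg c)
      have := mul_le_mul_of_nonneg_right hμ1 (sq_nonneg d)
      linarith [sq_nonneg ‖q'.2.2 - q.2.2‖]
    refine le_of_sq_le_sq ?_ (mul_nonneg hε hN0)
    calc (μ * (a * c + b * d)) ^ 2 ≤ (a ^ 2 + b ^ 2) * (μ ^ 2 * (c ^ 2 + d ^ 2)) := by
          nlinarith [mul_nonneg (sq_nonneg μ) (sq_nonneg (a * d - b * c))]
      _ ≤ ε ^ 2 * N ^ 2 := mul_le_mul he hcd (by positivity) (sq_nonneg ε)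
      _ = _ := by ring
  have hNN : N ^ 2 ≤ β * (a * c + b * d) := by
    have := mul_le_mul_of_nonneg_left (add_le_add c1 c2) hβ.le
    linarith
  rcases hN0.eq_or_lt with h | h
  · rw [← h, mul_zero]; positivity
  · refine le_of_mul_le_mul_right ?_ h
    calc μ * N * N = μ * N ^ 2 := by ring
      _ ≤ μ * (β * (a * c + b * d)) := mul_le_mul_of_nonneg_left hNN hμ0.le
      _ = β * (μ * (a * c + b * d)) := by ring
      _ ≤ β * (ε * N) := mul_le_mul_of_nonneg_left hX hβ.le
      _ = _ := by ring

/-- One step of the algorithm. -/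
theorem Problem.inexact_step (P : Problem n m) (hK : P.K.Nonempty)
    (hS : P.solutionSet.Nonempty) {r κ : ℝ} (hr : 0 < r) (hκ : 0 < κ)
    (herr : ∀ q, rdist 1 q P.solutionSet ≤ r → ∀ w ∈ P.T q,
      rdist 1 q P.solutionSet ≤ κ * normR 1 w)
    {τ β ε δ δ' : ℝ} (hτ : 0 < τ) (hβ : 0 < β) (hε : 0 ≤ ε) (hδ' : 0 ≤ δ') (hδ1 : δ' < 1)
    {p q : Triple n m}
    (hp : rdist τ p P.solutionSet ≤ r)
    (hF : distZeroPair (P.F β (β / τ) p q.1 q.2.1) ≤ ENNReal.ofReal ε)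
    (hz : q.2.2 = (p.2.2 + β • q.1) - β • proj P.K (β⁻¹ • p.2.2 + q.1))
    (hεle : ε ≤ min (Real.sqrt τ) 1 / β * min δ (δ' * normR τ (q - p))) :
    rdist τ q P.solutionSet ≤ rdist τ p P.solutionSet + δ ∧
    rdist τ q P.solutionSet ≤ rate κ β τ δ' * rdist τ p P.solutionSet := by
  obtain ⟨e, he, hen⟩ := exists_mem_norm_le_of_distZeroPair_le (P.isClosed_F _ _ _ _ _) hε hF
  obtain ⟨w', hw', e1', e2', e3'⟩ := P.exists_mem_T_of_mem_F hK hβ he hz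
  obtain ⟨s, w, hw, e1, e2, e3⟩ := P.exists_proximal_point hK hτ hβ p
  have hμ0 : 0 < min (Real.sqrt τ) 1 := lt_min (Real.sqrt_pos.2 hτ) one_pos
  have hN : normR τ (q - s) ≤ min δ (δ' * normR τ (q - p)) := by
    have h1 := P.normR_sub_proximal_le hτ hβ hε hen hw hw' e1 e2 e3 e1' e2' e3'
    have h2 := mul_le_mul_of_nonneg_left hεle hβ.le
    refine le_of_mul_le_mul_left (h1.trans (h2.trans_eq ?_)) hμ0
    field_simp
  obtain ⟨g1, g2, g3⟩ := P.proximal_step hK hS hr hκ herr hτ hβ hp hw e1 e2 e3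
  have htri := rdist_le_add (S := P.solutionSet) hτ.le q s
  refine ⟨by linarith [hN.trans (min_le_left _ _)], ?_⟩
  have h2 := hN.trans (min_le_right _ _)
  have h3 : normR τ (q - p) ≤ normR τ (q - s) + normR τ (p - s) := by
    rw [normR_sub_comm hτ.le p s]
    have := normR_add_le hτ.le (q - s) (s - p)
    rwa [sub_add_sub_cancel] at this
  rw [rate, inv_mul_eq_div, div_mul_eq_mul_div, le_div_iff₀ (by linarith)]
  set θ := κ * max τ 1 / Real.sqrt (β ^ 2 + κ ^ 2 * (max τ 1) ^ 2)
  have hd := rdist_nonneg (τ := τ) (S := P.solutionSet) s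
  have h4 := mul_le_mul_of_nonneg_left h3 hδ'
  have h5 := mul_le_mul_of_nonneg_left g1 hδ'
  have h6 := mul_le_mul_of_nonneg_left htri (by linarith : 0 ≤ 1 - δ')
  have h7 := mul_le_mul_of_nonneg_left g3 (by linarith : 0 ≤ 1 + δ')
  -- With `N = ‖q - s‖_R`, `h2`, `h3` and `g1` give `(1 - δ') N ≤ δ' dist_R(p)`. The exact part
  -- carries the coefficient `1 - δ'`, which is relaxed to `1 + δ'`.
  nlinarith [mul_nonneg hδ' hd]

/-! ### The limiting rate -/

lemma tendsto_rate {κ : ℝ} (hκ : 0 < κ) {β τ δ' : ℕ → ℝ} {βinf : EReal} {τinf : ℝ}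
    (hβ : Monotone β)
    (hβlim : Tendsto (fun k => ((β k : ℝ) : EReal)) atTop (𝓝 βinf))
    (hτlim : Tendsto τ atTop (𝓝 τinf)) (hδ' : Tendsto δ' atTop (𝓝 0)) :
    Tendsto (fun k => rate κ (β k) (τ k) (δ' k)) atTop (𝓝 (rateLimit κ βinf τinf)) := by
  have hγ : Tendsto (fun k => max (τ k) 1) atTop (𝓝 (max τinf 1)) :=
    hτlim.max tendsto_const_nhds
  have hθ : Tendsto (fun k => κ * max (τ k) 1
      / Real.sqrt ((β k) ^ 2 + κ ^ 2 * (max (τ k) 1) ^ 2)) atTop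
      (𝓝 (rateLimit κ βinf τinf)) := by
    unfold rateLimit
    split_ifs with h
    · subst h
      have hβt : Tendsto β atTop atTop := EReal.tendsto_coe_nhds_top_iff.1 hβlim
      refine (hγ.const_mul κ).div_atTop ?_
      refine tendsto_atTop_mono (fun k => ?_) hβt
      exact Real.le_sqrt_of_sq_le (by nlinarith [sq_nonneg (κ * max (τ k) 1)])
    -- `⊥` must be excluded too before `βinf.toReal` represents the limit.
    · have hge : ((β 0 : ℝ) : EReal) ≤ βinf :=
        ge_of_tendsto' hβlim fun k => EReal.coe_le_coe_iff.2 (hβ (Nat.zero_le k))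
      have hbot : βinf ≠ ⊥ := fun hb => by simp [hb] at hge
      rw [← EReal.coe_toReal h hbot] at hβlim
      have hβt : Tendsto β atTop (𝓝 βinf.toReal) := EReal.tendsto_coe.1 hβlim
      have hpos : 0 < max τinf 1 := lt_max_of_lt_right one_pos
      refine (hγ.const_mul κ).div ?_ (Real.sqrt_pos.2 (by positivity)).ne'
      exact ((hβt.pow 2).add ((hγ.pow 2).const_mul _)).sqrt
  have h1 : Tendsto (fun k => 1 - δ' k) atTop (𝓝 1) := by
    simpa using tendsto_const_nhds.sub hδ'
  have h2 : Tendsto (fun k => 1 + δ' k) atTop (𝓝 1) := by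
    simpa using tendsto_const_nhds.add hδ'
  simpa [rate] using (h1.inv₀ one_ne_zero).mul (hδ'.add (h2.mul hθ))

end PDPMM

theorem mainTheorem2 {n m : ℕ} (P : PDPMM.Problem n m)
    (hprimal : P.PrimalFeasible) (hdual : P.DualFeasible)
    (β : ℕ → ℝ) (βinf : EReal) (τ : ℕ → ℝ) (τinf : ℝ) (ε : ℕ → ℝ)
    (p : ℕ → PDPMM.Triple n m)
    (hrun : PDPMM.IsRun P β βinf τ τinf ε p)
    (δ δ' : ℕ → ℝ)
    (hδ : ∀ k, 0 ≤ δ k) (hδsum : Summable δ)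
    (hδ' : ∀ k, 0 ≤ δ' k ∧ δ' k < 1) (hδ'sum : Summable δ')
    (r κ : ℝ) (hr : ∑' k, δ k < r) (hκ : 0 < κ)
    (herr : ∀ q : PDPMM.Triple n m,
      PDPMM.dist2 q P.solutionSet ≤ ENNReal.ofReal r →
      PDPMM.dist2 q P.solutionSet ≤ ENNReal.ofReal κ * PDPMM.dist2 0 (P.T q))
    (hstart : PDPMM.distR (τ 0) (p 0) P.solutionSet ≤ ENNReal.ofReal (r - ∑' k, δ k))
    (hε : ∀ k, ε k ≤ min (Real.sqrt (τ k)) 1 / β k *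
      min (δ k) (δ' k * PDPMM.normR (τ k) (p (k + 1) - p k))) :
    (∀ k, PDPMM.distR (τ (k + 1)) (p (k + 1)) P.solutionSet ≤
      ENNReal.ofReal (PDPMM.rate κ (β k) (τ k) (δ' k)) *
        PDPMM.distR (τ k) (p k) P.solutionSet) ∧
    Tendsto (fun k => PDPMM.rate κ (β k) (τ k) (δ' k)) atTop
      (𝓝 (PDPMM.rateLimit κ βinf τinf)) := by
  open PDPMM in
  refine ⟨?_, tendsto_rate hκ hrun.β_mono hrun.β_lim hrun.τ_lim
    hδ'sum.tendsto_atTop_zero⟩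
  have hK : P.K.Nonempty := hprimal.imp fun _ h => h.1
  -- The starting distance is finite, whereas the distance to the empty set is `⊤`.
  have hS : P.solutionSet.Nonempty := by
    rw [Set.nonempty_iff_ne_empty]
    intro h
    simp [h, distR] at hstart
  have hτ : ∀ k, 0 < τ k := fun k =>
    hrun.τinf_pos.trans_le (hrun.τ_anti.le_of_tendsto hrun.τ_lim k)
  have hβ : ∀ k, 0 < β k := fun k => hrun.β_pos.trans_le (hrun.β_mono (Nat.zero_le k))
  have hsum0 : 0 ≤ ∑' k, δ k := tsum_nonneg hδ
  have hr0 : 0 < r := hsum0.trans_lt hr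
  have herr' : ∀ q, rdist 1 q P.solutionSet ≤ r → ∀ w ∈ P.T q,
      rdist 1 q P.solutionSet ≤ κ * normR 1 w := by
    intro q hq w hw
    have h1 := herr q
    rw [dist2, distR_eq_ofReal zero_le_one hS] at h1
    have h2 := h1 (ENNReal.ofReal_le_ofReal hq)
    have h3 : dist2 0 (P.T q) ≤ ENNReal.ofReal (normR 1 w) := by
      refine (iInf₂_le w hw).trans (le_of_eq ?_)
      rw [normR_sub_comm zero_le_one, sub_zero]
    have h4 := h2.trans (mul_le_mul_right h3 _)
    rw [← ENNReal.ofReal_mul hκ.le] at h4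
    exact (ENNReal.ofReal_le_ofReal_iff (mul_nonneg hκ.le (normR_nonneg _ _))).1 h4
  have hstep := fun k (hp : rdist (τ k) (p k) P.solutionSet ≤ r) =>
    P.inexact_step hK hS hr0 hκ herr' (hτ k) (hβ k) (hrun.ε_nonneg k) (hδ' k).1 (hδ' k).2 hp
      (hrun.subproblem k) (hrun.z_update k) (hε k)
  have hanti : ∀ k q, rdist (τ (k + 1)) q P.solutionSet ≤ rdist (τ k) q P.solutionSet := by
    intro k q
    simpa using rdist_le_mul (hτ (k + 1)).le (hτ k).le hS one_pos
      (fun v => by rw [one_mul]; exact normR_mono (hrun.τ_anti k.le_succ) v) q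
  have hpart : ∀ k, ∑ j ∈ Finset.range k, δ j ≤ ∑' j, δ j := fun k =>
    hδsum.sum_le_tsum _ fun j _ => hδ j
  -- Step `k` loses at most `δ k`, and the weights do not increase, so the slack `∑ δ` left at the
  -- start keeps every iterate within `R`-distance `r`.
  have hbound : ∀ k, rdist (τ k) (p k) P.solutionSet
      ≤ r - ∑' j, δ j + ∑ j ∈ Finset.range k, δ j := by
    intro k
    induction k with
    | zero =>
      rw [distR_eq_ofReal (hτ 0).le hS, ENNReal.ofReal_le_ofReal_iff (by linarith)] at hstart
      simpa using hstart
    | succ k ih =>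
      have h1 := (hstep k (ih.trans (by linarith [hpart k]))).1
      rw [Finset.sum_range_succ]
      linarith [hanti k (p (k + 1))]
  intro k
  have h1 := (hstep k ((hbound k).trans (by linarith [hpart k]))).2
  rw [distR_eq_ofReal (hτ _).le hS, distR_eq_ofReal (hτ _).le hS]
  have hrate : 0 ≤ rate κ (β k) (τ k) (δ' k) := by
    have h2 := (hδ' k).1
    have h3 : 0 ≤ 1 - δ' k := by linarith [(hδ' k).2]
    have h4 : 0 ≤ max (τ k) 1 := zero_le_one.trans (le_max_right _ _)
    unfold rate
    positivity
  rw [← ENNReal.ofReal_mul hrate]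
  exact ENNReal.ofReal_le_ofReal ((hanti k _).trans h1)
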